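/- Let $\Sigma$ be a finite alphabet. A factor of an infinite word $\mathbf{x}\in\Sigma^{\mathbb N}$ is a finite (possibly empty) block of consecutive letters of $\mathbf{x}$; let $\mathcal{L}(\mathbf{x})$ be the set of all factors of $\mathbf{x}$, and let $|v|$ denote the length of a finite word $v$ and $|v|_a$ the number of occurrences of the letter $a$ in $v$. The word $\mathbf{x}$ is *aperiodic* if it is not ultimately periodic, *recurrent* if each of its factors occurs in it infinitely many times, and *balanced* if $\bigl||v|_a-|v'|_a\bigr|\le 1$ for all $v,v'\in\mathcal{L}(\mathbf{x})$ with $|v|=|v'|$ and all $a\in\Sigma$. The *abelian closure* of $\mathbf{x}$ is $$\mathcal{A}(\mathbf{x})=\{\mathbf{y}\in\Sigma^{\mathbb N} : \forall v\in\mathcal{L}(\mathbf{y})\ \exists w\in\mathcal{L}(\mathbf{x})\ \forall a\in\Sigma,\ |v|_a=|w|_a\}.$$ A *subshift* is a non-empty set $X\subseteq\Sigma^{\mathbb N}$ that is closed in the product topology (with $\Sigma$ discrete) and satisfies $\sigma(X)\subseteq X$, where $\sigma(a_0a_1a_2\cdots)=a_1a_2\cdots$; it is *minimal* if it contains no subshift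 other than itself. **Theorem.** If $\mathbf{u}\in\Sigma^{\mathbb N}$ is aperiodic, recurrent and balanced, then its abelian closure $\mathcal{A}(\mathbf{u})$ is the union of finitely many minimal subshifts. -/

import Mathlib

open SymbolicDynamics.FullShift

namespace AbelianClosure

/-- The block of length `n` of the infinite word `x` starting at position `i`. -/
def block {A : Type*} (x : ℕ → A) (i n : ℕ) : List A :=
  (List.range n).map (fun j => x (i + j))

/-- The language of `x`: the set of its (finite, possibly empty) factors. -/
def language {A : Type*} (x : ℕ → A) : Set (List A) :=
  {w | ∃ i n : ℕ, w = block x i n}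

/-- Each factor of `x` occurs at infinitely many positions. -/
def IsRecurrent {A : Type*} (x : ℕ → A) : Prop :=
  ∀ w ∈ language x, {i : ℕ | block x i w.length = w}.Infinite

/-- `x` is not ultimately periodic. -/
def IsAperiodic {A : Type*} (x : ℕ → A) : Prop :=
  ¬ ∃ p N : ℕ, 0 < p ∧ ∀ n : ℕ, N ≤ n → x (n + p) = x n

/-- For any two factors of `x` of the same length and any letter `a`, the numbers of occurrences
of `a` in them differ by at most one. -/
def IsBalanced {A : Type*} [DecidableEq A] (x : ℕ → A) : Prop :=
  ∀ v ∈ language x, ∀ w ∈ language x, v.length = w.length →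
    ∀ a : A, |(v.count a : ℤ) - (w.count a : ℤ)| ≤ 1

/-- Two finite words are abelian equivalent if each letter occurs equally often in both. -/
def AbEquiv {A : Type*} [DecidableEq A] (v w : List A) : Prop :=
  ∀ a : A, v.count a = w.count a

/-- The abelian closure of `x`. -/
def abClosure {A : Type*} [DecidableEq A] (x : ℕ → A) : Set (ℕ → A) :=
  {y | ∀ v ∈ language y, ∃ w ∈ language x, AbEquiv v w}

/-- A subshift of `ℕ → A` is minimal if it is non-empty and contains no other non-empty
subshift. (Mathlib's `Subshift` allows the empty set.) -/
def IsMinimalSubshift {A : Type*} [TopologicalSpace A] (X : Subshift A ℕ) : Prop :=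
  X.carrier.Nonempty ∧
    ∀ Y : Subshift A ℕ, Y.carrier.Nonempty → Y.carrier ⊆ X.carrier → Y.carrier = X.carrier

end AbelianClosure

/-!
Let `α a` be the frequency of the letter `a`. In a word of the abelian closure the discrepancy of
`a` has oscillation at most one, so its distance to its supremum, the *height* of `a`, lies in
`[0, 1]` and is rotated by `α a` modulo `1` when a letter is read.

All nonzero frequencies are tied together. Fix `a` with `α a` irrational, let `C` be the set of
letters `b` whose height, multiplied by some integer `p b`, agrees with a fixed integer multiple of
the height of `a` modulo `1`, and choose `m` such that `m * α b` is nearly an integer for all `b`.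
A count of `b` in a block of length `m` is then the rounded value of `m * α b` unless the height of
`b` is near an integer. Translating the block by a suitable return time keeps the counts of the
letters of `C` and moves the heights of the letters independent of `a` away from the integers. At
the new position the heights of `C`, or those of all commensurable letters outside `C`, are also
away from the integers; as the counts add up to `m`, in both cases the number of letters of `C` in
the block has the expected value. So membership in `C` is eventually periodic along the word, and
since `a` occurs in every residue class of positions, all letters of nonzero frequency belong to
`C`.

If two words of the abelian closure share a long factor, their heights there are close for every
letter, hence differ by `G / p b` with one and the same `G`. The rotation can undo this
displacement up to an arbitrarily small error of prescribed sign, and then one word reproduces any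
given factor of the other. A long factor thus determines the language, so only finitely many
languages occur, and the words sharing a language form a minimal subshift.
-/

namespace AbelianClosure

open Filter Topology

section Rotations

variable {T : ℝ} [hT : Fact (0 < T)]

theorem exists_eq_zsmul_of_continuous (φ : AddCircle T →+ AddCircle T) (hφ : Continuous φ) :
    ∃ k : ℤ, ∀ x, φ x = k • x := by
  let f : C(AddCircle T, ℂ) := ⟨fun x => (φ x).toCircle, by fun_prop⟩
  have hf : ∀ x t, f (t + x) = f t * f x := fun x t => by simp [f, AddCircle.toCircle_add]
  obtain ⟨k, hk⟩ : ∃ k, fourierCoeff f k ≠ 0 := by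
    by_contra! h
    have hsum := has_pointwise_sum_fourier_series_of_summable (f := f)
      (summable_zero.congr fun k => (h k).symm) 0
    simp only [h, zero_smul] at hsum
    simpa [f] using hsum.unique hasSum_zero
  have hmul : ∀ x, fourierCoeff f k = fourier (-k) x * f x * fourierCoeff f k := fun x => by
    simp only [fourierCoeff, smul_eq_mul]
    refine (MeasureTheory.integral_add_right_eq_self _ x).symm.trans ?_
    rw [← MeasureTheory.integral_const_mul]
    congr 1 with t
    simp only [hf, fourier_apply, smul_add, AddCircle.toCircle_add, Circle.coe_mul]
    ring
  refine ⟨k, fun x => AddCircle.injective_toCircle hT.out.ne' (Circle.ext ?_)⟩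
  have h1 : fourier (-k) x * f x = 1 := (mul_eq_right₀ hk).1 (hmul x).symm
  calc f x = fourier k x * (fourier (-k) x * f x) := by
        rw [← mul_assoc, ← fourier_add, add_neg_cancel, fourier_zero, one_mul]
    _ = (k • x).toCircle := by rw [h1, mul_one, fourier_apply]

theorem exists_eq_zsmul_of_ker_le {G : Type*} [AddGroup G] [TopologicalSpace G] [CompactSpace G]
    {π ψ : G →+ AddCircle T} (hπ : Continuous π) (hψ : Continuous ψ)
    (hsurj : Function.Surjective π) (hker : π.ker ≤ ψ.ker) : ∃ k : ℤ, ∀ g, ψ g = k • π g := by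
  let φ := π.liftOfSurjective hsurj ⟨ψ, hker⟩
  have hφ : ∀ g, φ (π g) = ψ g := π.liftOfRightInverse_comp_apply _ _ ⟨ψ, hker⟩
  have hcont : Continuous φ := by
    rw [(hπ.isClosedMap.isQuotientMap hπ hsurj).continuous_iff]
    exact hψ.congr fun g => (hφ g).symm
  obtain ⟨k, hk⟩ := exists_eq_zsmul_of_continuous φ hcont
  exact ⟨k, fun g => by rw [← hφ, hk]⟩

-- B. H. Neumann's lemma: finitely many subgroups of infinite index do not cover a group.
theorem exists_forall_apply_ne_zero {ι G M : Type*} [Finite ι] [AddGroup G] [AddGroup M]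
    (ψ : ι → G →+ M) (h : ∀ i (l : ℕ), l ≠ 0 → ∃ g, l • ψ i g ≠ 0) : ∃ g, ∀ i, ψ i g ≠ 0 := by
  cases nonempty_fintype ι
  by_contra! hcover
  obtain ⟨i, -, hi⟩ := AddSubgroup.exists_finiteIndex_of_leftCoset_cover
    (s := Finset.univ) (g := fun _ => 0) (H := fun i => (ψ i).ker) (by
      ext g
      simpa using hcover g)
  obtain ⟨g, hg⟩ := h i _ hi.index_ne_zero
  exact hg (by simpa using (ψ i).ker.nsmul_index_mem g)

theorem denseRange_nsmul {x : AddCircle T} (hx : ¬ IsOfFinAddOrder x) :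
    DenseRange fun n : ℕ => n • x := by
  rwa [← denseRange_zsmul_iff_nsmul, AddCircle.denseRange_zsmul_iff, addOrderOf_eq_zero_iff]

theorem exists_nat_forall_exists_nsmul_near {x : AddCircle T} (hx : ¬ IsOfFinAddOrder x)
    {η : ℝ} (hη : 0 < η) : ∃ N : ℕ, ∀ z, ∃ n < N, ‖n • x - z‖ < η := by
  obtain ⟨t, ht⟩ := isCompact_univ.elim_finite_subcover (fun n : ℕ => Metric.ball (n • x) η)
    (fun _ => Metric.isOpen_ball) fun z _ =>
      Set.mem_iUnion.2 ((denseRange_nsmul hx).exists_dist_lt z hη)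
  refine ⟨t.sup id + 1, fun z => ?_⟩
  obtain ⟨n, hn, hz⟩ := Set.mem_iUnion₂.1 (ht (Set.mem_univ z))
  exact ⟨n, Nat.lt_succ_of_le (t.le_sup (f := id) hn), by rwa [← dist_eq_norm, dist_comm]⟩

theorem exists_ge_nsmul_near {x : AddCircle T} (hx : ¬ IsOfFinAddOrder x) {η : ℝ} (hη : 0 < η)
    (z : AddCircle T) (M : ℕ) : ∃ n ≥ M, ‖n • x - z‖ < η := by
  obtain ⟨n, hn⟩ := (denseRange_nsmul hx).exists_dist_lt (z - M • x) hη
  refine ⟨M + n, Nat.le_add_right M n, ?_⟩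
  rwa [dist_comm, dist_eq_norm, sub_sub_eq_add_sub, add_comm, ← add_nsmul] at hn

theorem exists_ge_forall_nsmul_eq_coe_div {κ : Type*} [Finite κ] {x : AddCircle T}
    {v : κ → AddCircle T} {p : κ → ℤ} (hx : ¬ IsOfFinAddOrder x) (hp : ∀ k, p k ≠ 0)
    (hv : ∀ k, p k • v k = x) (M : ℕ) {c d : ℝ} (hcd : c < d) :
    ∃ n ≥ M, ∃ θ ∈ Set.Ioo c d, ∀ k, n • v k = (θ / p k : ℝ) := by
  cases nonempty_fintype κ
  obtain ⟨W, hW, hdvd⟩ : ∃ W : ℕ, 0 < W ∧ ∀ k, p k ∣ W :=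
    ⟨(∏ k, p k).natAbs, Int.natAbs_pos.2 (Finset.prod_ne_zero_iff.2 fun k _ => hp k),
      fun k => Int.dvd_natAbs.2 (Finset.dvd_prod_of_mem p (Finset.mem_univ k))⟩
  choose w hw using hdvd
  obtain ⟨n, hn, hnear⟩ := exists_ge_nsmul_near hx (div_pos (half_pos (sub_pos.2 hcd))
    (Nat.cast_pos.2 hW)) (((c + d) / 2 / W : ℝ) : AddCircle T) M
  obtain ⟨e, he, hlt⟩ := QuotientAddGroup.norm_lt_iff.1 hnear
  rw [Real.norm_eq_abs, lt_div_iff₀ (by positivity), ← abs_of_pos (Nat.cast_pos (α := ℝ).2 hW),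
    ← abs_mul, abs_lt] at hlt
  refine ⟨n * W, hn.trans (Nat.le_mul_of_pos_right n hW), (c + d) / 2 + e * W,
    ⟨by linarith [hlt.1], by linarith [hlt.2]⟩, fun k => ?_⟩
  have hWk : (W : ℝ) = p k * w k := by exact_mod_cast hw k
  have hpk : (p k : ℝ) ≠ 0 := Int.cast_ne_zero.2 (hp k)
  calc (n * W) • v k = w k • n • x := by
        rw [mul_smul, ← natCast_zsmul (v k) W, hw k, ← hv k, mul_comm, mul_smul, smul_comm n]
    _ = w k • (((c + d) / 2 / W + e : ℝ) : AddCircle T) := by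
        rw [AddCircle.coe_add]
        exact congrArg _ (sub_eq_iff_eq_add'.1 he.symm)
    _ = (((c + d) / 2 + e * W) / p k : ℝ) := by
        rw [← AddCircle.coe_zsmul, zsmul_eq_mul]
        congr 1
        field_simp
        rw [hWk]
        ring

theorem exists_mem_topologicalClosure_nsmul_apply_ne_zero {ι : Type*} {x : AddCircle T}
    {β : ι → AddCircle T} (hx : ¬ IsOfFinAddOrder x) {i : ι}
    (hβ : ∀ k l : ℤ, k • x + l • β i = 0 → l = 0) {n : ℕ} (hn : n ≠ 0) :
    ∃ h : ι → AddCircle T, (0, h) ∈ (AddSubgroup.zmultiples (x, β)).topologicalClosure ∧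
      n • h i ≠ 0 := by
  set G := (AddSubgroup.zmultiples (x, β)).topologicalClosure
  have : CompactSpace G :=
    isCompact_iff_compactSpace.1 (AddSubgroup.isClosed_topologicalClosure _).isCompact
  let π : G →+ AddCircle T := (AddMonoidHom.fst _ _).comp G.subtype
  let ψ : G →+ AddCircle T :=
    (Pi.evalAddMonoidHom _ i).comp ((AddMonoidHom.snd _ _).comp G.subtype)
  have hπ : Continuous π := continuous_fst.comp continuous_subtype_val
  have hψ : Continuous ψ :=
    (continuous_apply i).comp (continuous_snd.comp continuous_subtype_val)
  have hmem : ∀ k : ℤ, k • (x, β) ∈ G := fun k =>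
    AddSubgroup.le_topologicalClosure _ (AddSubgroup.zsmul_mem_zmultiples _ k)
  have hsurj : Function.Surjective π := by
    rw [← Set.range_eq_univ, ← (isCompact_range hπ).isClosed.closure_eq, ← dense_iff_closure_eq]
    have hdense : DenseRange fun k : ℤ => k • x :=
      denseRange_zsmul_iff_nsmul.2 (denseRange_nsmul hx)
    exact hdense.mono (Set.range_subset_iff.2 fun k => ⟨⟨_, hmem k⟩, rfl⟩)
  by_contra! h
  have hker : π.ker ≤ (n • ψ).ker := fun ⟨⟨x', h'⟩, hg⟩ hx' => by
    obtain rfl : x' = 0 := hx'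
    exact h h' hg
  obtain ⟨k, hk⟩ := exists_eq_zsmul_of_ker_le hπ (hψ.const_smul n) hsurj hker
  have hrel : n • β i = k • x := hk ⟨(x, β), by simpa only [one_zsmul] using hmem 1⟩
  refine hn (Int.natCast_eq_zero.1 (hβ (-k) n ?_))
  rw [natCast_zsmul, hrel, neg_smul, neg_add_cancel]

theorem exists_mem_topologicalClosure_forall_nsmul_ne_zero {ι : Type*} [Finite ι]
    {x : AddCircle T} {β : ι → AddCircle T} (hx : ¬ IsOfFinAddOrder x)
    (hβ : ∀ i, ∀ k l : ℤ, k • x + l • β i = 0 → l = 0) {s : Finset ℕ} (hs : 0 ∉ s) :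
    ∃ h : ι → AddCircle T, (0, h) ∈ (AddSubgroup.zmultiples (x, β)).topologicalClosure ∧
      ∀ i, ∀ j ∈ s, j • h i ≠ 0 := by
  let K := (AddSubgroup.zmultiples (x, β)).topologicalClosure.comap (AddMonoidHom.inr _ _)
  obtain ⟨h, hne⟩ := exists_forall_apply_ne_zero
    (fun q : ι × s => (q.2 : ℕ) • (Pi.evalAddMonoidHom _ q.1).comp K.subtype) fun q l hl => by
      obtain ⟨h, hmem, hne⟩ := exists_mem_topologicalClosure_nsmul_apply_ne_zero hx (hβ q.1)
        (mul_ne_zero hl fun h0 => hs (h0 ▸ q.2.2))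
      exact ⟨⟨h, hmem⟩, by rwa [mul_smul] at hne⟩
  exact ⟨h, h.2, fun i j hj => hne (i, ⟨j, hj⟩)⟩

theorem exists_forall_le_norm_nsmul_add_of_forall {ι E : Type*} [Fintype ι]
    [SeminormedAddCommGroup E] {γ : ι → E} {ε : ℝ}
    (h : ∀ i, ∀ j ∈ Finset.Icc 1 (Fintype.card ι), 2 * ε ≤ ‖j • γ i‖) (z : ι → E) :
    ∃ s ≤ Fintype.card ι, ∀ i, ε ≤ ‖s • γ i + z i‖ := by
  -- Otherwise two of these multiples fail at the same index, and their difference is too small.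
  by_contra! hbad
  choose f hf using fun s : Fin (Fintype.card ι + 1) => hbad s (Nat.lt_succ_iff.1 s.2)
  obtain ⟨s, s', hne, hfs⟩ := Fintype.exists_ne_map_eq_of_card_lt f (by simp)
  wlog hlt : s < s' generalizing s s'
  · exact this s' s hne.symm hfs.symm (hne.symm.lt_of_le (not_lt.1 hlt))
  obtain ⟨j, hj⟩ := Nat.exists_eq_add_of_lt hlt
  have hdiff : (j + 1) • γ (f s) =
      ((s' : ℕ) • γ (f s') + z (f s')) - ((s : ℕ) • γ (f s) + z (f s)) := by
    rw [← hfs, hj, add_assoc, add_nsmul _ (s : ℕ), add_sub_add_right_eq_sub, add_sub_cancel_left]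
  have hsep := h (f s) (j + 1) (Finset.mem_Icc.2 ⟨Nat.le_add_left 1 j, by omega⟩)
  rw [hdiff] at hsep
  linarith [norm_sub_le ((s' : ℕ) • γ (f s') + z (f s')) ((s : ℕ) • γ (f s) + z (f s)),
    hf s, hf s']

theorem exists_forall_le_norm_nsmul_add {ι : Type*} [Finite ι] {x : AddCircle T}
    {β : ι → AddCircle T} (hx : ¬ IsOfFinAddOrder x)
    (hβ : ∀ i, ∀ k l : ℤ, k • x + l • β i = 0 → l = 0) :
    ∃ ε > 0, ∀ z : ι → AddCircle T, ∀ δ > 0, ∃ t : ℕ, ‖t • x‖ < δ ∧ ∀ i, ε ≤ ‖t • β i + z i‖ := by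
  cases nonempty_fintype ι
  obtain ⟨h, hmem, hne⟩ :=
    exists_mem_topologicalClosure_forall_nsmul_ne_zero hx hβ
      (s := Finset.Icc 1 (Fintype.card ι)) (by simp)
  obtain ⟨ε, hε, hεh⟩ := Pi.exists_forall_pos_add_lt (x := 0)
    (y := fun p : ι × Finset.Icc 1 (Fintype.card ι) => ‖(p.2 : ℕ) • h p.1‖ / 2)
    fun p => half_pos (norm_pos_iff.2 (hne p.1 p.2 p.2.2))
  refine ⟨ε, hε, fun z δ hδ => ?_⟩
  have hnear : ∀ᶠ p in 𝓝 ((0 : AddCircle T), h), (Fintype.card ι + 1) * ‖p.1‖ < δ ∧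
      ∀ q : ι × Finset.Icc 1 (Fintype.card ι), 2 * ε < ‖(q.2 : ℕ) • p.2 q.1‖ := by
    refine .and (ContinuousAt.eventually_lt (by fun_prop) (by fun_prop) (by simpa)) <|
      eventually_all.2 fun q => ContinuousAt.eventually_lt (by fun_prop) (by fun_prop) ?_
    have hq : ε < ‖(q.2 : ℕ) • h q.1‖ / 2 := by simpa only [Pi.zero_apply, zero_add] using hεh q
    linarith
  have hcluster := mapClusterPt_atTop_nsmul_iff_mem_topologicalClosure_zmultiples.2 hmem
  obtain ⟨t, htx, htβ⟩ := (hcluster.frequently hnear).exists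
  obtain ⟨s, hs, hsz⟩ := exists_forall_le_norm_nsmul_add_of_forall (γ := t • β)
    (fun i j hj => (htβ (i, ⟨j, hj⟩)).le) z
  refine ⟨s * t, ?_, fun i => by rw [mul_smul]; exact hsz i⟩
  calc ‖(s * t) • x‖ ≤ s * ‖t • x‖ := by rw [mul_smul]; exact norm_nsmul_le
    _ ≤ (Fintype.card ι + 1) * ‖t • x‖ := by gcongr; exact_mod_cast hs.trans (Nat.le_succ _)
    _ < δ := htx

theorem exists_forall_norm_nsmul_lt_and_le_norm_nsmul_add {ι κ : Type*} [Finite ι] [Finite κ]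
    {x : AddCircle T} {v : κ → AddCircle T} {p : κ → ℤ} {β : ι → AddCircle T}
    (hx : ¬ IsOfFinAddOrder x) (hp : ∀ k, p k ≠ 0) (hv : ∀ k, p k • v k = x)
    (hβ : ∀ i, ∀ k l : ℤ, k • x + l • β i = 0 → l = 0) :
    ∃ ε > 0, ∀ z : ι → AddCircle T, ∀ δ > 0, ∃ t : ℕ,
      (∀ k, ‖t • v k‖ < δ) ∧ ∀ i, ε ≤ ‖t • β i + z i‖ := by
  cases nonempty_fintype κ
  set W : ℤ := ∏ k, p k
  have hW : W ≠ 0 := Finset.prod_ne_zero_iff.2 fun k _ => hp k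
  choose d hd using fun k => Finset.dvd_prod_of_mem p (Finset.mem_univ k)
  obtain ⟨ε, hε, hreturn⟩ := exists_forall_le_norm_nsmul_add (β := fun i => W.natAbs • β i) hx
    fun i k l h => by
      rw [← natCast_zsmul, ← mul_smul] at h
      exact (mul_eq_zero.1 (hβ i k _ h)).resolve_right (by simpa)
  refine ⟨ε, hε, fun z δ hδ => ?_⟩
  obtain ⟨s, hsx, hsβ⟩ := hreturn z (δ / |(W : ℝ)|) (by positivity)
  refine ⟨s * W.natAbs, fun k => ?_, fun i => by rw [mul_smul]; exact hsβ i⟩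
  have hdW : |(d k : ℝ)| ≤ |(W : ℝ)| := by
    rw [show W = p k * d k from hd k, Int.cast_mul, abs_mul]
    exact le_mul_of_one_le_left (abs_nonneg _) (by exact_mod_cast Int.one_le_abs (hp k))
  calc ‖(s * W.natAbs) • v k‖ = ‖d k • s • x‖ := by
        rw [mul_smul, smul_comm s, norm_natAbs_smul, ← hv k, smul_comm s, ← mul_smul, mul_comm,
          show W = _ from hd k]
    _ ≤ |(d k : ℝ)| * ‖s • x‖ := norm_zsmul_le (d k) (s • x)
    _ ≤ |(W : ℝ)| * ‖s • x‖ := by gcongr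
    _ < δ := by rwa [lt_div_iff₀' (by positivity)] at hsx

theorem exists_pos_forall_norm_nsmul_lt {ι : Type*} [Finite ι] (v : ι → AddCircle T) {ε : ℝ}
    (hε : 0 < ε) : ∃ m > 0, ∀ i, ‖m • v i‖ < ε ∧ (IsOfFinAddOrder (v i) → m • v i = 0) := by
  cases nonempty_fintype ι
  classical
  set W : ℕ := ∏ i with IsOfFinAddOrder (v i), addOrderOf (v i)
  have hW : 0 < W := Finset.prod_pos fun i hi => addOrderOf_pos_iff.2 (Finset.mem_filter.1 hi).2
  obtain ⟨n, hn, hpos⟩ := ((mapClusterPt_zero_atTop_nsmul (W • v)).frequently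
    (Metric.ball_mem_nhds 0 hε)).and_eventually (eventually_gt_atTop 0) |>.exists
  rw [dist_zero_right, pi_norm_lt_iff hε] at hn
  refine ⟨n * W, by positivity, fun i => ⟨by rw [mul_smul]; exact hn i, fun hi => ?_⟩⟩
  exact addOrderOf_dvd_iff_nsmul_eq_zero.1 <| Dvd.dvd.mul_left
    (Finset.dvd_prod_of_mem _ (Finset.mem_filter.2 ⟨Finset.mem_univ i, hi⟩)) n

theorem exists_zsmul_eq_zsmul_or_independent {ι M : Type*} [Finite ι] [AddCommGroup M] (x : M)
    (v : ι → M) : ∃ (q : ℤ) (p : ι → ℤ), q ≠ 0 ∧ (∀ i, p i ≠ 0) ∧ ∀ i, IsOfFinAddOrder (v i) ∨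
      p i • v i = q • x ∨ ∀ k l : ℤ, k • x + l • v i = 0 → l = 0 := by
  cases nonempty_fintype ι
  have hrel : ∀ i, ∃ k l : ℤ, k ≠ 0 ∧ l ≠ 0 ∧ (IsOfFinAddOrder (v i) ∨
      l • v i = k • x ∨ ∀ k l : ℤ, k • x + l • v i = 0 → l = 0) := fun i => by
    by_contra! h
    obtain ⟨hfin, -, k, l, hkl, hl⟩ := h 1 1 one_ne_zero one_ne_zero
    rcases eq_or_ne k 0 with rfl | hk
    · rw [zero_smul, zero_add] at hkl
      exact hfin (isOfFinAddOrder_iff_zsmul_eq_zero.2 ⟨l, hl, hkl⟩)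
    · refine (h (-k) l (neg_ne_zero.2 hk) hl).2.1 ?_
      rw [neg_smul]
      exact eq_neg_of_add_eq_zero_right hkl
  choose k l hk hl hkl using hrel
  choose d hd using fun i => Finset.dvd_prod_of_mem k (Finset.mem_univ i)
  have hq : ∏ i, k i ≠ 0 := Finset.prod_ne_zero_iff.2 fun i _ => hk i
  refine ⟨∏ i, k i, fun i => d i * l i, hq, fun i => ?_, fun i =>
    (hkl i).imp_right (Or.imp_left fun h => ?_)⟩
  · exact mul_ne_zero (fun h => hq (by rw [hd i, h, mul_zero])) (hl i)
  · rw [hd i, mul_smul, h, ← mul_smul, mul_comm]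

end Rotations

section Counting

variable {A : Type*}

theorem length_block (y : ℕ → A) (i n : ℕ) : (block y i n).length = n := by
  simp [block]

theorem block_eq_block_iff {y z : ℕ → A} {i j n : ℕ} :
    block y i n = block z j n ↔ ∀ q < n, y (i + q) = z (j + q) := by
  simp [block, List.map_inj_left]

variable [DecidableEq A]

/-- The number of occurrences of `a` in the block of length `n` at position `i`, as an integer so
that numbers of occurrences can be subtracted. -/
def occ (y : ℕ → A) (a : A) (i n : ℕ) : ℤ := (block y i n).count a

theorem occ_zero (y : ℕ → A) (a : A) (i : ℕ) : occ y a i 0 = 0 := by simp [occ, block]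

theorem occ_succ (y : ℕ → A) (a : A) (i n : ℕ) :
    occ y a i (n + 1) = occ y a i n + if y (i + n) = a then 1 else 0 := by
  simp [occ, block, List.range_succ, List.count_singleton]

theorem occ_add (y : ℕ → A) (a : A) (i n m : ℕ) :
    occ y a i (n + m) = occ y a i n + occ y a (i + n) m := by
  induction m with
  | zero => simp [occ_zero]
  | succ m ih => rw [← add_assoc, occ_succ, ih, occ_succ, add_assoc, add_assoc]

theorem occ_one (y : ℕ → A) (a : A) (i : ℕ) : occ y a i 1 = if y i = a then 1 else 0 := by
  rw [occ_succ, occ_zero]; simp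

theorem occ_nonneg (y : ℕ → A) (a : A) (i n : ℕ) : 0 ≤ occ y a i n := by simp [occ]

theorem occ_congr {y z : ℕ → A} {i j n : ℕ} (h : ∀ q < n, y (i + q) = z (j + q)) (a : A) :
    occ y a i n = occ z a j n := by
  rw [occ, occ, block_eq_block_iff.2 h]

theorem occ_eq_zero {y : ℕ → A} {a : A} {i : ℕ} (h : ∀ q, y (i + q) ≠ a) (n : ℕ) :
    occ y a i n = 0 := by
  induction n with
  | zero => exact occ_zero y a i
  | succ n ih => rw [occ_succ, ih, if_neg (h n), add_zero]

theorem mem_iff_mem_of_sum_occ_eq {y : ℕ → A} {C : Finset A} {i n : ℕ}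
    (h : ∑ a ∈ C, occ y a (i + 1) n = ∑ a ∈ C, occ y a i n) : y (i + n) ∈ C ↔ y i ∈ C := by
  have hshift : ∑ a ∈ C, occ y a i 1 + ∑ a ∈ C, occ y a (i + 1) n =
      ∑ a ∈ C, occ y a i n + ∑ a ∈ C, occ y a (i + n) 1 := by
    simp only [← Finset.sum_add_distrib, ← occ_add, add_comm 1 n]
  simp only [h, occ_one, Finset.sum_ite_eq] at hshift
  split_ifs at hshift <;> simp_all

theorem sum_occ [Fintype A] (y : ℕ → A) (i n : ℕ) : ∑ a, occ y a i n = n := by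
  induction n with
  | zero => simp [occ_zero]
  | succ n ih => simp [occ_succ, Finset.sum_add_distrib, ih]

theorem apply_eq_of_forall_occ_eq {y z : ℕ → A} {s k L : ℕ}
    (h : ∀ q ≤ L, ∀ a, occ y a s q = occ z a k q) : ∀ q < L, y (s + q) = z (k + q) := by
  intro q hq
  have hsucc := h (q + 1) hq (z (k + q))
  rw [occ_succ, occ_succ, h q hq.le, if_pos rfl, add_right_inj] at hsucc
  by_contra hne
  simp [hne] at hsucc

theorem apply_eq_of_forall_occ_le_add [Finite A] {y z : ℕ → A} {e : A → ℤ} {s k L : ℕ}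
    (hle : ∀ q ≤ L, ∀ a, occ y a s q ≤ occ z a k q + e a)
    (hge : ∃ q, ∀ a, occ z a k q + e a ≤ occ y a s q) : ∀ q < L, y (s + q) = z (k + q) := by
  cases nonempty_fintype A
  -- Both sides of `hle` have the same sum over the letters, up to `∑ a, e a`, which `hge` bounds.
  have hsum : ∀ q, ∑ a, (occ z a k q + e a) = ∑ a, occ y a s q + ∑ a, e a := fun q => by
    rw [Finset.sum_add_distrib, sum_occ, sum_occ]
  obtain ⟨q₀, hq₀⟩ := hge
  have he : ∑ a, e a ≤ 0 := by
    linarith [hsum q₀, Finset.sum_le_sum (s := Finset.univ) fun a _ => hq₀ a]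
  have heq : ∀ q ≤ L, ∀ a, occ y a s q = occ z a k q + e a := fun q hq a =>
    (Finset.sum_eq_sum_iff_of_le fun a _ => hle q hq a).1
      ((Finset.sum_le_sum fun a _ => hle q hq a).antisymm (by linarith [hsum q])) a
      (Finset.mem_univ a)
  have hzero : ∀ a, e a = 0 := fun a => by simpa [occ_zero] using (heq 0 (Nat.zero_le L) a).symm
  exact apply_eq_of_forall_occ_eq fun q hq a => by rw [heq q hq, hzero, add_zero]

/-- Every letter `a` has frequency `α a` in `y`, with balanced counts, and letters of frequency
zero do not occur. This is what the balance of a recurrent word says about every word in its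
abelian closure. -/
structure IsBalancedWith (α : A → ℝ) (y : ℕ → A) : Prop where
  abs_occ_sub_le : ∀ a i n, |(occ y a i n : ℝ) - n * α a| ≤ 1
  abs_occ_sub_occ_le : ∀ a i j n, |occ y a i n - occ y a j n| ≤ 1
  ne_of_eq_zero : ∀ a, α a = 0 → ∀ n, y n ≠ a

theorem abs_occ_sub_occ_le_of_isBalanced {u : ℕ → A} (hu : IsBalanced u) (a : A) (i j n : ℕ) :
    |occ u a i n - occ u a j n| ≤ 1 :=
  hu _ ⟨i, n, rfl⟩ _ ⟨j, n, rfl⟩ (by simp [length_block]) a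

theorem abs_occ_mul_sub_le_of_isBalanced {u : ℕ → A} (hu : IsBalanced u) (a : A) (i j n k : ℕ) :
    |occ u a i (n * k) - k * occ u a j n| ≤ k := by
  induction k with
  | zero => simp [occ_zero]
  | succ k ih =>
    have h := abs_le.1 (abs_occ_sub_occ_le_of_isBalanced hu a (i + n * k) j n)
    rw [mul_add, mul_one, occ_add]
    rw [abs_le] at ih ⊢
    push_cast
    constructor <;> linarith

theorem exists_slope_of_isBalanced {u : ℕ → A} (hu : IsBalanced u) (a : A) :
    ∃ α : ℝ, ∀ i n, |(occ u a i n : ℝ) - n * α| ≤ 1 := by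
  have hcross : ∀ i j n k : ℕ, 0 < n → 0 < k →
      ((occ u a i n : ℝ) - 1) / n ≤ (occ u a j k + 1) / k := fun i j n k hn hk => by
    have h1 := (abs_le.1 (abs_occ_mul_sub_le_of_isBalanced hu a 0 i n k)).1
    have h2 := (abs_le.1 (abs_occ_mul_sub_le_of_isBalanced hu a 0 j k n)).2
    rw [mul_comm k n] at h2
    rw [div_le_div_iff₀ (by exact_mod_cast hn) (by exact_mod_cast hk)]
    have h3 : (occ u a i n - 1) * k ≤ (occ u a j k + 1) * n := by linarith
    exact_mod_cast h3
  obtain ⟨α, hlower, hupper⟩ := exists_between_of_forall_le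
    (Set.range_nonempty fun p : ℕ × ℕ => ((occ u a p.1 (p.2 + 1) : ℝ) - 1) / (p.2 + 1 : ℕ))
    (Set.range_nonempty fun p : ℕ × ℕ => ((occ u a p.1 (p.2 + 1) : ℝ) + 1) / (p.2 + 1 : ℕ))
    (by
      rintro _ ⟨p, rfl⟩ _ ⟨q, rfl⟩
      exact hcross _ _ _ _ p.2.succ_pos q.2.succ_pos)
  refine ⟨α, fun i n => ?_⟩
  cases n with
  | zero => simp [occ_zero]
  | succ n =>
    have h1 := hlower ⟨(i, n), rfl⟩
    have h2 := hupper ⟨(i, n), rfl⟩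
    have hn : (0 : ℝ) < (n + 1 : ℕ) := by positivity
    rw [div_le_iff₀' hn] at h1
    rw [le_div_iff₀' hn] at h2
    rw [abs_le]
    constructor <;> linarith

theorem exists_isBalancedWith {u : ℕ → A} (hu : IsBalanced u) (hrec : IsRecurrent u) :
    ∃ α, IsBalancedWith α u := by
  choose α hα using exists_slope_of_isBalanced hu
  refine ⟨α, hα, abs_occ_sub_occ_le_of_isBalanced hu, fun a ha n hn => ?_⟩
  have hinf : {i | u i = a}.Infinite := by
    simpa [block] using hrec [a] ⟨n, 1, by simp [block, hn]⟩
  obtain ⟨j, hj, hij⟩ := hinf.exists_gt n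
  obtain ⟨k, rfl⟩ := Nat.exists_eq_add_of_lt hij
  have htwo : occ u a n (1 + k + 1) = 2 + occ u a (n + 1) k := by
    rw [occ_succ, occ_add, occ_one, if_pos hn, if_pos (by rw [← hj.out]; congr 1; omega)]
    ring
  have hle := (abs_le.1 (hα a n (1 + k + 1))).2
  rw [htwo, ha] at hle
  have hnonneg : (0 : ℝ) ≤ occ u a (n + 1) k := by exact_mod_cast occ_nonneg u a (n + 1) k
  push_cast at hle
  linarith

theorem exists_occ_eq_of_mem_abClosure {u y : ℕ → A} (hy : y ∈ abClosure u) (i n : ℕ) :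
    ∃ j, ∀ a, occ y a i n = occ u a j n := by
  obtain ⟨w, ⟨j, m, rfl⟩, h⟩ := hy _ ⟨i, n, rfl⟩
  have hl := (List.perm_iff_count.2 h).length_eq
  rw [length_block, length_block] at hl
  subst hl
  exact ⟨j, fun a => by rw [occ, occ, h a]⟩

theorem IsBalancedWith.of_mem_abClosure {α : A → ℝ} {u y : ℕ → A} (hu : IsBalancedWith α u)
    (hy : y ∈ abClosure u) : IsBalancedWith α y where
  abs_occ_sub_le a i n := by
    obtain ⟨j, hj⟩ := exists_occ_eq_of_mem_abClosure hy i n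
    rw [hj]; exact hu.abs_occ_sub_le a j n
  abs_occ_sub_occ_le a i i' n := by
    obtain ⟨j, hj⟩ := exists_occ_eq_of_mem_abClosure hy i n
    obtain ⟨j', hj'⟩ := exists_occ_eq_of_mem_abClosure hy i' n
    rw [hj, hj']; exact hu.abs_occ_sub_occ_le a j j' n
  ne_of_eq_zero a ha n hn := by
    obtain ⟨j, hj⟩ := exists_occ_eq_of_mem_abClosure hy n 1
    have := hj a
    rw [occ_eq_zero fun q => hu.ne_of_eq_zero a ha _, occ_one, if_pos hn] at this
    exact one_ne_zero this

end Counting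

section Heights

variable {A : Type*} [DecidableEq A] {α : A → ℝ} {y : ℕ → A} {a b : A} {n m t : ℕ}

/-- The distance of the discrepancy of `a` at `n` from its supremum. In a balanced word it lies
between `0` and `1`, and reading the next letter rotates it by the frequency of `a` modulo `1`. -/
noncomputable def height (α : A → ℝ) (y : ℕ → A) (a : A) (n : ℕ) : ℝ :=
  (⨆ m : ℕ, ((occ y a 0 m : ℝ) - m * α a)) - (occ y a 0 n - n * α a)

/-- The height of `a` at `n` modulo `1`. -/
noncomputable def phase (α : A → ℝ) (y : ℕ → A) (a : A) (n : ℕ) : UnitAddCircle :=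
  height α y a n

theorem height_add (α : A → ℝ) (y : ℕ → A) (a : A) (n m : ℕ) :
    height α y a (n + m) = height α y a n + m * α a - occ y a n m := by
  simp only [height, occ_add y a 0 n m]
  push_cast
  simp only [zero_add]
  ring

theorem height_succ (α : A → ℝ) (y : ℕ → A) (a : A) (n : ℕ) :
    height α y a (n + 1) = height α y a n + α a - if y n = a then 1 else 0 := by
  rw [height_add, occ_one]; push_cast; simp

theorem phase_add (α : A → ℝ) (y : ℕ → A) (a : A) (n m : ℕ) :
    phase α y a (n + m) = phase α y a n + m • (α a : UnitAddCircle) := by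
  have h : ((occ y a n m : ℝ) : UnitAddCircle) = 0 :=
    (AddCircle.coe_eq_zero_iff 1).2 ⟨occ y a n m, by simp⟩
  rw [phase, height_add, AddCircle.coe_sub, AddCircle.coe_add, h, sub_zero, ← nsmul_eq_mul,
    AddCircle.coe_nsmul, phase]

theorem zsmul_phase_injective {k : ℤ} (ha : ¬ IsOfFinAddOrder (k • (α a : UnitAddCircle))) :
    Function.Injective fun n => k • phase α y a n := fun n n' h => by
  wlog hle : n ≤ n' generalizing n n'
  · exact (this n' n h.symm (le_of_not_ge hle)).symm
  obtain ⟨m, rfl⟩ := Nat.exists_eq_add_of_le hle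
  simp only [phase_add, smul_add, left_eq_add, smul_comm k] at h
  by_contra hm
  exact ha (isOfFinAddOrder_iff_nsmul_eq_zero.2 ⟨m, by omega, h⟩)

theorem eventually_phase_ne_zero (ha : ¬ IsOfFinAddOrder (α a : UnitAddCircle)) :
    ∀ᶠ n in atTop, phase α y a n ≠ 0 := by
  have hinj : Function.Injective (phase α y a) := by
    simpa only [one_smul] using zsmul_phase_injective (k := 1) (by rwa [one_smul])
  rw [← Nat.cofinite_eq_atTop]
  exact ((Set.subsingleton_singleton (a := (0 : UnitAddCircle))).preimage
    hinj).finite.compl_mem_cofinite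

theorem norm_coe_le_abs_sub_intCast (x : ℝ) (k : ℤ) : ‖(x : UnitAddCircle)‖ ≤ |x - k| := by
  rw [UnitAddCircle.norm_eq]
  exact round_le x k

namespace IsBalancedWith

theorem bddAbove_range (hy : IsBalancedWith α y) (a : A) :
    BddAbove (Set.range fun m : ℕ => (occ y a 0 m : ℝ) - m * α a) :=
  ⟨1, by rintro _ ⟨m, rfl⟩; exact (abs_le.1 (hy.abs_occ_sub_le a 0 m)).2⟩

theorem height_nonneg (hy : IsBalancedWith α y) (a : A) (n : ℕ) : 0 ≤ height α y a n :=
  sub_nonneg.2 (le_ciSup (hy.bddAbove_range a) n)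

theorem height_le_one (hy : IsBalancedWith α y) (a : A) (n : ℕ) : height α y a n ≤ 1 := by
  rw [height, sub_le_iff_le_add]
  refine ciSup_le fun m => ?_
  rcases le_total m n with h | h
  · obtain ⟨k, rfl⟩ := Nat.exists_eq_add_of_le h
    have := (abs_le.1 (hy.abs_occ_sub_le a (0 + m) k)).1
    rw [occ_add]; push_cast; linarith
  · obtain ⟨k, rfl⟩ := Nat.exists_eq_add_of_le h
    have := (abs_le.1 (hy.abs_occ_sub_le a (0 + n) k)).2
    rw [occ_add]; push_cast; linarith

theorem slope_nonneg (hy : IsBalancedWith α y) (a : A) : 0 ≤ α a := by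
  by_contra! h
  obtain ⟨n, hn⟩ := exists_nat_gt (1 / -α a)
  rw [div_lt_iff₀ (by linarith)] at hn
  have h1 := (abs_le.1 (hy.abs_occ_sub_le a 0 n)).2
  have h0 : (0 : ℝ) ≤ occ y a 0 n := by exact_mod_cast occ_nonneg y a 0 n
  linarith

theorem sum_slope [Fintype A] (hy : IsBalancedWith α y) : ∑ a, α a = 1 := by
  have h : ∀ n : ℕ, (n : ℝ) * |1 - ∑ a, α a| ≤ Fintype.card A := by
    intro n
    have e : (n : ℝ) * (1 - ∑ a, α a) = ∑ a, ((occ y a 0 n : ℝ) - n * α a) := by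
      rw [Finset.sum_sub_distrib, ← Finset.mul_sum, ← Int.cast_sum, sum_occ]; push_cast; ring
    rw [← Nat.abs_cast n, ← abs_mul, e]
    calc _ ≤ ∑ a, |(occ y a 0 n : ℝ) - n * α a| := Finset.abs_sum_le_sum_abs _ _
      _ ≤ ∑ _ : A, (1 : ℝ) := Finset.sum_le_sum fun a _ => hy.abs_occ_sub_le a 0 n
      _ = _ := by simp
  by_contra hne
  have hpos : 0 < |1 - ∑ a, α a| := abs_pos.2 (sub_ne_zero.2 (Ne.symm hne))
  obtain ⟨n, hn⟩ := exists_nat_gt (Fintype.card A / |1 - ∑ a, α a|)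
  rw [div_lt_iff₀ hpos] at hn
  linarith [h n]

theorem slope_le_one [Finite A] (hy : IsBalancedWith α y) (a : A) : α a ≤ 1 := by
  cases nonempty_fintype A
  rw [← hy.sum_slope]
  exact Finset.single_le_sum (fun b _ => hy.slope_nonneg b) (Finset.mem_univ a)

theorem eq_of_lt_height (hy : IsBalancedWith α y) {a : A} {n : ℕ} (h : 1 - α a < height α y a n) :
    y n = a := by
  by_contra hne
  have h1 := height_succ α y a n
  rw [if_neg hne] at h1
  linarith [hy.height_le_one a (n + 1)]

theorem norm_phase_le (hy : IsBalancedWith α y) (a : A) (n : ℕ) :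
    ‖phase α y a n‖ ≤ min (height α y a n) (1 - height α y a n) := by
  have h0 := norm_coe_le_abs_sub_intCast (height α y a n) 0
  have h1 := norm_coe_le_abs_sub_intCast (height α y a n) 1
  push_cast at h0 h1
  rw [sub_zero, abs_of_nonneg (hy.height_nonneg a n)] at h0
  rw [abs_sub_comm, abs_of_nonneg (sub_nonneg.2 (hy.height_le_one a n))] at h1
  exact le_min h0 h1

theorem occ_eq_round (hy : IsBalancedWith α y)
    (h : ‖m • (α a : UnitAddCircle)‖ < ‖phase α y a n‖) : occ y a n m = round (m * α a) := by
  have hlt := h.trans_le (hy.norm_phase_le a n)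
  rw [← AddCircle.coe_nsmul, UnitAddCircle.norm_eq, nsmul_eq_mul, lt_min_iff, abs_lt, abs_lt] at hlt
  have hadd := height_add α y a n m
  have hlow : (occ y a n m : ℝ) < (round (m * α a) + 1 : ℤ) := by
    push_cast; linarith [hy.height_nonneg a (n + m)]
  have hupp : ((round (m * α a) - 1 : ℤ) : ℝ) < occ y a n m := by
    push_cast; linarith [hy.height_le_one a (n + m)]
  rw [Int.cast_lt] at hlow hupp
  omega

theorem occ_add_eq (hy : IsBalancedWith α y) (h : ‖t • (α a : UnitAddCircle)‖ < ‖phase α y a n‖)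
    (h' : ‖t • (α a : UnitAddCircle)‖ < ‖phase α y a (n + m)‖) :
    occ y a (n + t) m = occ y a n m := by
  have hcomm : occ y a n t + occ y a (n + t) m = occ y a n m + occ y a (n + m) t := by
    rw [← occ_add, ← occ_add, add_comm]
  rw [hy.occ_eq_round h, hy.occ_eq_round h'] at hcomm
  linarith

theorem eq_of_norm_phase_add_lt [Finite A] (hy : IsBalancedWith α y)
    (h : ‖phase α y a n + (α a / 2 : ℝ)‖ < α a / 2) : y n = a := by
  rw [phase, ← AddCircle.coe_add, UnitAddCircle.norm_eq, abs_lt] at h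
  have h0 := hy.height_nonneg a n
  have h1 := hy.height_le_one a n
  have hα := hy.slope_le_one a
  have hround : round (height α y a n + α a / 2) = 1 := by
    have hlow : (0 : ℝ) < round (height α y a n + α a / 2) := by linarith
    have hupp : (round (height α y a n + α a / 2) : ℝ) < 2 := by linarith
    have hlow' : 0 < round (height α y a n + α a / 2) := by exact_mod_cast hlow
    have hupp' : round (height α y a n + α a / 2) < 2 := by exact_mod_cast hupp
    omega
  rw [hround] at h
  push_cast at h
  exact hy.eq_of_lt_height (by linarith)

theorem exists_ge_apply_add_mul_eq [Finite A] (hy : IsBalancedWith α y)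
    (ha : ¬ IsOfFinAddOrder (α a : UnitAddCircle)) (hm : 0 < m) (i M : ℕ) :
    ∃ k ≥ M, y (i + k * m) = a := by
  have hpos : 0 < α a := (hy.slope_nonneg a).lt_of_ne fun h => ha (by
    rw [← h, AddCircle.coe_zero]; exact IsOfFinAddOrder.zero)
  have hma : ¬ IsOfFinAddOrder (m • (α a : UnitAddCircle)) := fun h =>
    ha ((isOfFinAddOrder_nsmul.1 h).resolve_right hm.ne')
  obtain ⟨k, hk, hnear⟩ := exists_ge_nsmul_near hma (half_pos hpos)
    (-(phase α y a i + (α a / 2 : ℝ))) M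
  refine ⟨k, hk, hy.eq_of_norm_phase_add_lt ?_⟩
  rwa [phase_add, mul_smul, add_right_comm, add_comm, ← sub_neg_eq_add]

theorem exists_ge_apply_eq (hy : IsBalancedWith α y) (hb : α b ≠ 0) (M : ℕ) : ∃ n ≥ M, y n = b := by
  by_contra! h
  obtain ⟨n, hn⟩ := exists_nat_gt (1 / α b)
  rw [div_lt_iff₀ ((hy.slope_nonneg b).lt_of_ne' hb)] at hn
  have hocc := (abs_le.1 (hy.abs_occ_sub_le b M n)).1
  rw [occ_eq_zero (fun q => h _ (Nat.le_add_right M q))] at hocc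
  push_cast at hocc
  linarith

end IsBalancedWith

end Heights

section RationalSlopes

variable {A : Type*} [DecidableEq A] {α : A → ℝ} {y : ℕ → A}

theorem eventually_eq_zero_of_sub_eq {h : ℕ → ℝ} {e : ℕ → ℤ} {m : ℕ} (h0 : ∀ n, 0 ≤ h n)
    (h1 : ∀ n, h n ≤ 1) (he : ∀ n, h n - h (n + m) = e n) (hpos : ∀ n, 0 ≤ e n) :
    ∀ᶠ n in atTop, e n = 0 := by
  have hsum : ∀ M, ∑ i ∈ Finset.range M, (e i : ℝ) ≤ m := fun M => by
    have hswap := Finset.sum_range_add h m M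
    rw [add_comm m M, Finset.sum_range_add h M m] at hswap
    have hle : ∑ i ∈ Finset.range m, h i ≤ m := by
      simpa using Finset.sum_le_sum fun i (_ : i ∈ Finset.range m) => h1 i
    have hnonneg : 0 ≤ ∑ i ∈ Finset.range m, h (M + i) := Finset.sum_nonneg fun i _ => h0 _
    simp only [← he, Finset.sum_sub_distrib, add_comm _ m]
    linarith
  have hlim :=
    (summable_of_sum_range_le (fun i => by exact_mod_cast hpos i) hsum).tendsto_atTop_zero
  filter_upwards [hlim.eventually_lt_const one_pos] with n hn
  have hn' : e n < 1 := by exact_mod_cast hn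
  have := hpos n
  omega

namespace IsBalancedWith

theorem eventually_occ_eq_round_of_nsmul_eq_zero (hy : IsBalancedWith α y) {b : A} {m : ℕ}
    (hb : m • (α b : UnitAddCircle) = 0) : ∀ᶠ n in atTop, occ y b n m = round (m * α b) := by
  rw [← AddCircle.coe_nsmul, AddCircle.coe_eq_zero_iff] at hb
  obtain ⟨k, hk⟩ := hb
  simp only [zsmul_eq_mul, mul_one, nsmul_eq_mul] at hk
  have hstep : ∀ n, height α y b n - height α y b (n + m) = (occ y b n m - k : ℤ) := fun n => by
    rw [height_add, ← hk]; push_cast; ring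
  suffices h : ∀ᶠ n in atTop, occ y b n m - k = 0 by
    simpa only [← hk, round_intCast, sub_eq_zero] using h
  by_cases hpos : ∀ n, 0 ≤ occ y b n m - k
  · exact eventually_eq_zero_of_sub_eq (hy.height_nonneg b) (hy.height_le_one b) hstep hpos
  · push Not at hpos
    obtain ⟨i, hi⟩ := hpos
    refine (eventually_eq_zero_of_sub_eq (h := fun n => 1 - height α y b n)
      (e := fun n => -(occ y b n m - k)) (fun n => sub_nonneg.2 (hy.height_le_one b n))
      (fun n => by linarith [hy.height_nonneg b n])
      (fun n => by rw [Int.cast_neg, ← hstep n]; ring) fun n => ?_).mono fun n => neg_eq_zero.1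
    have := (abs_le.1 (hy.abs_occ_sub_occ_le b n i m)).2
    omega

theorem exists_not_isOfFinAddOrder [Finite A] {u : ℕ → A} (hu : IsBalancedWith α u)
    (haper : IsAperiodic u) : ∃ a, ¬ IsOfFinAddOrder (α a : UnitAddCircle) := by
  by_contra! hfin
  obtain ⟨m, hm, hzero⟩ := exists_pos_forall_norm_nsmul_lt (fun a => (α a : UnitAddCircle)) one_pos
  obtain ⟨N, hN⟩ := eventually_atTop.1 <| eventually_all.2 fun b =>
    hu.eventually_occ_eq_round_of_nsmul_eq_zero ((hzero b).2 (hfin b))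
  refine haper ⟨m, N, hm, fun n hn => ?_⟩
  rw [← Finset.mem_singleton, mem_iff_mem_of_sum_occ_eq, Finset.mem_singleton]
  rw [Finset.sum_singleton, Finset.sum_singleton, hN n hn, hN (n + 1) (hn.trans n.le_succ)]

end IsBalancedWith

end RationalSlopes

section Synchronization

variable {A : Type*} {α : A → ℝ} {y : ℕ → A} {a b c : A} {p : A → ℤ}

/-- Multipliers `p` putting the frequencies commensurable with that of `a` on a common scale: modulo
`1`, each frequency is rational, or its multiple by `p` is that of the frequency of `a`, or it is
independent of the frequency of `a`. -/
structure IsCommonScale (α : A → ℝ) (a : A) (p : A → ℤ) : Prop where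
  ne_zero : ∀ b, p b ≠ 0
  trichotomy : ∀ b, IsOfFinAddOrder (α b : UnitAddCircle) ∨
    p b • (α b : UnitAddCircle) = p a • (α a : UnitAddCircle) ∨
    ∀ k l : ℤ, k • p a • (α a : UnitAddCircle) + l • (α b : UnitAddCircle) = 0 → l = 0

theorem exists_isCommonScale [Finite A] (ha : ¬ IsOfFinAddOrder (α a : UnitAddCircle)) :
    ∃ p, IsCommonScale α a p := by
  obtain ⟨q, p, -, hp, h⟩ := exists_zsmul_eq_zsmul_or_independent (α a : UnitAddCircle)
    fun b => (α b : UnitAddCircle)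
  have hpa : p a • (α a : UnitAddCircle) = q • (α a : UnitAddCircle) :=
    ((h a).resolve_left ha).resolve_right fun hind =>
      one_ne_zero (hind (-1) 1 (by rw [neg_smul, neg_add_cancel]))
  refine ⟨p, hp, fun b => (h b).imp_right (Or.imp (·.trans hpa.symm) fun hind k l hkl => ?_)⟩
  rw [hpa, ← mul_smul] at hkl
  exact hind _ l hkl

theorem exists_pos_forall_lt_norm {ι E : Type*} [Finite ι] [NormedAddGroup E] {v : ι → E}
    (hv : ∀ i, v i ≠ 0) : ∃ ε > 0, ∀ i, ε < ‖v i‖ := by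
  simpa using Pi.exists_forall_pos_add_lt (x := 0) (y := fun i => ‖v i‖)
    fun i => norm_pos_iff.2 (hv i)

theorem zsmul_phase_sub_zsmul_phase [DecidableEq A] {k l : ℤ}
    (h : k • (α b : UnitAddCircle) = l • (α c : UnitAddCircle)) (n : ℕ) :
    k • phase α y b n - l • phase α y c n = k • phase α y b 0 - l • phase α y c 0 := by
  rw [← zero_add n, phase_add, phase_add, smul_add, smul_add, smul_comm k, smul_comm l, h,
    add_sub_add_right_eq_sub]

theorem not_isOfFinAddOrder_zsmul {G : Type*} [AddGroup G] {x : G} {k : ℤ}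
    (hx : ¬ IsOfFinAddOrder x) (hk : k ≠ 0) : ¬ IsOfFinAddOrder (k • x) := fun h => by
  obtain ⟨n, hn, hzero⟩ := isOfFinAddOrder_iff_zsmul_eq_zero.1 h
  exact hx (isOfFinAddOrder_iff_zsmul_eq_zero.2 ⟨n * k, mul_ne_zero hn hk, by rwa [mul_smul]⟩)

namespace IsCommonScale

theorem not_isOfFinAddOrder (hp : IsCommonScale α a p)
    (ha : ¬ IsOfFinAddOrder (α a : UnitAddCircle))
    (hb : p b • (α b : UnitAddCircle) = p a • (α a : UnitAddCircle)) :
    ¬ IsOfFinAddOrder (α b : UnitAddCircle) := fun h =>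
  not_isOfFinAddOrder_zsmul ha (hp.ne_zero a) (hb ▸ h.zsmul)

theorem exists_pos_forall_exists_occ_eq [Finite A] [DecidableEq A] (hp : IsCommonScale α a p)
    (hy : IsBalancedWith α y) (ha : ¬ IsOfFinAddOrder (α a : UnitAddCircle)) :
    ∃ ε > 0, ∀ m : ℕ, (∀ b, ‖m • (α b : UnitAddCircle)‖ < ε) → ∀ᶠ n in atTop, ∃ n' ≥ n,
      (∀ b, p b • (α b : UnitAddCircle) = p a • (α a : UnitAddCircle) →
        occ y b n' m = occ y b n m) ∧
      ∀ b, ¬ IsOfFinAddOrder (α b : UnitAddCircle) →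
        p b • (α b : UnitAddCircle) ≠ p a • (α a : UnitAddCircle) →
        occ y b n' m = round (m * α b) := by
  let K := {b // p b • (α b : UnitAddCircle) = p a • (α a : UnitAddCircle)}
  let I := {b // ¬ IsOfFinAddOrder (α b : UnitAddCircle) ∧
    p b • (α b : UnitAddCircle) ≠ p a • (α a : UnitAddCircle)}
  obtain ⟨ε, hε, hreturn⟩ := exists_forall_norm_nsmul_lt_and_le_norm_nsmul_add
    (not_isOfFinAddOrder_zsmul ha (hp.ne_zero a)) (fun b : K => hp.ne_zero b) (fun b : K => b.2)
    fun b : I => ((hp.trichotomy b).resolve_left b.2.1).resolve_left b.2.2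
  have hne : ∀ᶠ n in atTop, ∀ b : K, phase α y b n ≠ 0 := eventually_all.2 fun b =>
    eventually_phase_ne_zero (hp.not_isOfFinAddOrder ha b.2)
  refine ⟨ε, hε, fun m hm => ?_⟩
  filter_upwards [hne, (tendsto_add_atTop_nat m).eventually hne] with n hn hnm
  obtain ⟨δ, hδ, hδn⟩ := exists_pos_forall_lt_norm hn
  obtain ⟨δ', hδ', hδnm⟩ := exists_pos_forall_lt_norm hnm
  obtain ⟨t, hK, hI⟩ := hreturn (fun b => phase α y b n) (min δ δ') (lt_min hδ hδ')
  refine ⟨n + t, Nat.le_add_right n t, fun b hb => ?_, fun b hb hb' => ?_⟩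
  · have ht := lt_min_iff.1 (hK ⟨b, hb⟩)
    exact hy.occ_add_eq (ht.1.trans (hδn ⟨b, hb⟩)) (ht.2.trans (hδnm ⟨b, hb⟩))
  · refine hy.occ_eq_round ((hm b).trans_le ?_)
    rw [phase_add, add_comm]
    exact hI ⟨b, hb, hb'⟩

end IsCommonScale

theorem sum_round_eq [DecidableEq A] [Fintype A] (hy : IsBalancedWith α y) {m : ℕ}
    (hm : ∀ b, ‖m • (α b : UnitAddCircle)‖ < 1 / Fintype.card A) : ∑ b, round (m * α b) = m := by
  have : Nonempty A := ⟨y 0⟩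
  have hsum : ∑ b, ((m * α b : ℝ) - round (m * α b)) = m - (∑ b, round (m * α b) : ℤ) := by
    rw [Finset.sum_sub_distrib, ← Finset.mul_sum, hy.sum_slope, mul_one, Int.cast_sum]
  have hlt : |((m - ∑ b, round (m * α b) : ℤ) : ℝ)| < 1 := by
    push_cast at hsum ⊢
    rw [← hsum]
    calc _ ≤ ∑ b, |(m * α b : ℝ) - round (m * α b)| := Finset.abs_sum_le_sum_abs _ _
      _ < ∑ _ : A, 1 / (Fintype.card A : ℝ) := Finset.sum_lt_sum_of_nonempty Finset.univ_nonempty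
          fun b _ => by
            have := hm b
            rwa [← AddCircle.coe_nsmul, UnitAddCircle.norm_eq, nsmul_eq_mul] at this
      _ = 1 := by simp
  have hlt' : |(m - ∑ b, round (m * α b) : ℤ)| < 1 := by exact_mod_cast hlt
  linarith [Int.abs_lt_one_iff.1 hlt']

variable [DecidableEq A] [Finite A]

/-- The letters whose frequency is commensurable with that of `a` and whose height determines that
of `a`: on the common scale given by `p`, their phases agree with the phase of `a`. By
`zsmul_phase_sub_zsmul_phase` it is enough to compare the phases at position `0`. -/
noncomputable def syncLetters (α : A → ℝ) (p : A → ℤ) (y : ℕ → A) (a : A) : Finset A :=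
  (Set.toFinite {b | p b • (α b : UnitAddCircle) = p a • (α a : UnitAddCircle) ∧
    p b • phase α y b 0 = p a • phase α y a 0}).toFinset

theorem mem_syncLetters : b ∈ syncLetters α p y a ↔
    p b • (α b : UnitAddCircle) = p a • (α a : UnitAddCircle) ∧
      p b • phase α y b 0 = p a • phase α y a 0 := by
  simp [syncLetters]

theorem zsmul_phase_eq_of_mem_syncLetters (hb : b ∈ syncLetters α p y a) (n : ℕ) :
    p b • phase α y b n = p a • phase α y a n := by
  rw [mem_syncLetters] at hb
  rw [← sub_eq_zero, zsmul_phase_sub_zsmul_phase hb.1, hb.2, sub_self]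

theorem exists_pos_forall_le_norm_phase (α : A → ℝ) (p : A → ℤ) (y : ℕ → A) (a : A) :
    ∃ ε > 0, ∀ n, (∀ b ∈ syncLetters α p y a, ε ≤ ‖phase α y b n‖) ∨
      ∀ c ∉ syncLetters α p y a, p c • (α c : UnitAddCircle) = p a • (α a : UnitAddCircle) →
        ε ≤ ‖phase α y c n‖ := by
  let D := {c // c ∉ syncLetters α p y a ∧
    p c • (α c : UnitAddCircle) = p a • (α a : UnitAddCircle)}
  obtain ⟨ε, hε, hεD⟩ := exists_pos_forall_lt_norm
    (v := fun c : D => p c • phase α y c 0 - p a • phase α y a 0)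
    fun c h => c.2.1 (mem_syncLetters.2 ⟨c.2.2, sub_eq_zero.1 h⟩)
  obtain ⟨P, hpP⟩ := Finite.exists_le fun b => max 1 |(p b : ℝ)|
  have hpos : 0 < P := one_pos.trans_le ((le_max_left _ _).trans (hpP a))
  have hP : ∀ (b : A) (x : UnitAddCircle), ‖x‖ < ε / (2 * P) → ‖p b • x‖ < ε / 2 := fun b x hx => by
    have hpb : |(p b : ℝ)| ≤ P := (le_max_right _ _).trans (hpP b)
    calc ‖p b • x‖ ≤ |(p b : ℝ)| * ‖x‖ := norm_zsmul_le _ _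
      _ ≤ P * ‖x‖ := by gcongr
      _ < P * (ε / (2 * P)) := by gcongr
      _ = ε / 2 := by field_simp
  refine ⟨ε / (2 * P), by positivity, fun n => ?_⟩
  by_contra! h
  obtain ⟨⟨b, hb, hbn⟩, c, hc, hca, hcn⟩ := h
  have hlt := hεD ⟨c, hc, hca⟩
  rw [← zsmul_phase_sub_zsmul_phase hca n, ← zsmul_phase_eq_of_mem_syncLetters hb] at hlt
  linarith [norm_sub_le (p c • phase α y c n) (p b • phase α y b n), hP b _ hbn, hP c _ hcn]

theorem IsCommonScale.exists_eventually_sum_occ_eq (hp : IsCommonScale α a p)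
    (hy : IsBalancedWith α y) (ha : ¬ IsOfFinAddOrder (α a : UnitAddCircle)) :
    ∃ m > 0, ∀ᶠ n in atTop, ∑ b ∈ syncLetters α p y a, occ y b n m =
      ∑ b ∈ syncLetters α p y a, round (m * α b) := by
  cases nonempty_fintype A
  set C := syncLetters α p y a
  have : Nonempty A := ⟨a⟩
  obtain ⟨ε₁, hε₁, htranslate⟩ := hp.exists_pos_forall_exists_occ_eq hy ha
  obtain ⟨ε₂, hε₂, hfar⟩ := exists_pos_forall_le_norm_phase α p y a
  obtain ⟨m, hm, hsmall⟩ := exists_pos_forall_norm_nsmul_lt (fun b => (α b : UnitAddCircle))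
    (show 0 < min (min ε₁ ε₂) (1 / (Fintype.card A : ℝ)) by positivity)
  simp only [lt_min_iff] at hsmall
  have hrational : ∀ᶠ n in atTop, ∀ b, IsOfFinAddOrder (α b : UnitAddCircle) →
      occ y b n m = round (m * α b) := eventually_all.2 fun b => eventually_imp_distrib_left.2
    fun hb => hy.eventually_occ_eq_round_of_nsmul_eq_zero ((hsmall b).2 hb)
  obtain ⟨N, hN⟩ := eventually_atTop.1 hrational
  refine ⟨m, hm, ?_⟩
  filter_upwards [htranslate m fun b => (hsmall b).1.1.1, eventually_ge_atTop N] with n hn hNn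
  obtain ⟨n', hn', hsync, hind⟩ := hn
  rw [← Finset.sum_congr rfl fun b hb => hsync b (mem_syncLetters.1 hb).1]
  rcases hfar n' with h | h
  · exact Finset.sum_congr rfl fun b hb => hy.occ_eq_round ((hsmall b).1.1.2.trans_le (h b hb))
  · have hcompl : ∑ b ∈ Cᶜ, occ y b n' m = ∑ b ∈ Cᶜ, round (m * α b) :=
      Finset.sum_congr rfl fun b hb => by
        by_cases hfin : IsOfFinAddOrder (α b : UnitAddCircle)
        · exact hN n' (hNn.trans hn') b hfin
        by_cases hcomm : p b • (α b : UnitAddCircle) = p a • (α a : UnitAddCircle)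
        · exact hy.occ_eq_round ((hsmall b).1.1.2.trans_le (h b (Finset.mem_compl.1 hb) hcomm))
        · exact hind b hfin hcomm
    have htotal := sum_occ y n' m
    rw [← sum_round_eq hy fun b => (hsmall b).1.2, ← Finset.sum_add_sum_compl C,
      ← Finset.sum_add_sum_compl C fun b => round (m * α b), hcompl] at htotal
    exact add_right_cancel htotal

theorem IsCommonScale.mem_syncLetters_of_slope_ne_zero (hp : IsCommonScale α a p)
    (hy : IsBalancedWith α y) (ha : ¬ IsOfFinAddOrder (α a : UnitAddCircle)) (hb : α b ≠ 0) :
    b ∈ syncLetters α p y a := by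
  obtain ⟨m, hm, hsum⟩ := hp.exists_eventually_sum_occ_eq hy ha
  obtain ⟨N, hN⟩ := eventually_atTop.1 hsum
  obtain ⟨n, hn, rfl⟩ := hy.exists_ge_apply_eq hb N
  have hperiodic : ∀ k, y (n + k * m) ∈ syncLetters α p y a ↔ y n ∈ syncLetters α p y a := by
    intro k
    induction k with
    | zero => simp
    | succ k ih =>
      have hge : N ≤ n + k * m := hn.trans (Nat.le_add_right _ _)
      rw [← ih, add_one_mul, ← add_assoc]
      exact mem_iff_mem_of_sum_occ_eq ((hN _ (hge.trans (Nat.le_succ _))).trans (hN _ hge).symm)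
  obtain ⟨k, -, hk⟩ := hy.exists_ge_apply_add_mul_eq ha hm n 0
  exact (hperiodic k).1 (hk ▸ mem_syncLetters.2 ⟨rfl, rfl⟩)

end Synchronization

section CommonFactors

variable {A : Type*} [DecidableEq A] {α : A → ℝ} {y z : ℕ → A} {a b b' : A} {p : A → ℤ}
  {i j k n n' s : ℕ}

theorem tendsto_height_add_div (α : A → ℝ) (z : ℕ → A) (b : A) (r : ℝ) (n : ℕ) :
    Tendsto (fun θ : ℝ => height α z b n + θ / r) (𝓝 0) (𝓝 (height α z b n)) :=
  Continuous.tendsto' (by fun_prop) _ _ (by rw [zero_div, add_zero])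

namespace IsBalancedWith

theorem height_sub_height_le (hy : IsBalancedWith α y) (hz : IsBalancedWith α z) {η : ℝ}
    (hn : ‖phase α y b (i + n) - (η / 2 : ℝ)‖ < η / 2)
    (hyz : ∀ q < n, y (i + q) = z (j + q)) :
    height α y b i - height α z b j ≤ η := by
  -- Reading `n` letters changes both heights equally, leaving `y` with at most `η` and `z` with at
  -- least `0`.
  rw [phase, ← AddCircle.coe_sub, UnitAddCircle.norm_eq, abs_lt] at hn
  have hround : (round (height α y b (i + n) - η / 2) : ℝ) ≤ 0 := by
    have hlt : (round (height α y b (i + n) - η / 2) : ℝ) < 1 := by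
      linarith [hy.height_le_one b (i + n)]
    exact_mod_cast Int.lt_add_one_iff.1 (by exact_mod_cast hlt)
  have hyn := height_add α y b i n
  have hzn := height_add α z b j n
  rw [occ_congr hyz] at hyn
  linarith [hz.height_nonneg b (j + n)]

theorem abs_height_sub_height_le (hy : IsBalancedWith α y) (hz : IsBalancedWith α z) {η : ℝ}
    {N : ℕ} (hN : ∀ x : UnitAddCircle, ∃ n < N, ‖n • (α b : UnitAddCircle) - x‖ < η / 2)
    (hyz : ∀ q < N, y (i + q) = z (j + q)) : |height α y b i - height α z b j| ≤ η := by
  have hnear : ∀ y i, ∃ n < N, ‖phase α y b (i + n) - (η / 2 : ℝ)‖ < η / 2 := fun y i => by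
    obtain ⟨n, hn, h⟩ := hN ((η / 2 : ℝ) - phase α y b i)
    exact ⟨n, hn, by rwa [phase_add, add_comm, ← sub_sub_eq_add_sub]⟩
  obtain ⟨n, hn, hy'⟩ := hnear y i
  obtain ⟨m, hm, hz'⟩ := hnear z j
  have h1 := hy.height_sub_height_le hz hy' fun q hq => hyz q (hq.trans hn)
  have h2 := hz.height_sub_height_le hy hz' fun q hq => (hyz q (hq.trans hm)).symm
  exact abs_le.2 ⟨by linarith, h1⟩

theorem exists_forall_abs_height_sub_height_le [Finite A] (α : A → ℝ) {η : ℝ} (hη : 0 < η) :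
    ∃ N, ∀ y z i j, IsBalancedWith α y → IsBalancedWith α z → (∀ q < N, y (i + q) = z (j + q)) →
      ∀ b, ¬ IsOfFinAddOrder (α b : UnitAddCircle) → |height α y b i - height α z b j| ≤ η := by
  cases nonempty_fintype A
  choose! N hN using fun b (hb : ¬ IsOfFinAddOrder (α b : UnitAddCircle)) =>
    exists_nat_forall_exists_nsmul_near hb (half_pos hη)
  exact ⟨Finset.univ.sup N, fun y z i j hy hz hyz b hb => hy.abs_height_sub_height_le hz (hN b hb)
    fun q hq => hyz q (hq.trans_le (Finset.le_sup (Finset.mem_univ b)))⟩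

theorem exists_height_eq_add_intCast {τ : ℝ}
    (h : phase α y b s = phase α z b k + (τ : UnitAddCircle)) :
    ∃ e : ℤ, ∀ q, height α y b (s + q) =
      height α z b (k + q) + τ + (occ z b k q + e - occ y b s q : ℤ) := by
  rw [phase, phase, ← AddCircle.coe_add, ← sub_eq_zero, ← AddCircle.coe_sub,
    AddCircle.coe_eq_zero_iff] at h
  obtain ⟨e, he⟩ := h
  rw [zsmul_eq_mul, mul_one] at he
  refine ⟨e, fun q => ?_⟩
  rw [height_add, height_add]
  push_cast
  linarith

theorem apply_eq_of_phase_eq_phase_add [Finite A] (hy : IsBalancedWith α y)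
    (hz : IsBalancedWith α z) {τ : A → ℝ} {L : ℕ}
    (hphase : ∀ b, α b ≠ 0 → phase α y b s = phase α z b k + (τ b : UnitAddCircle))
    (hlt : ∀ b, α b ≠ 0 → ∀ q ≤ L, height α z b (k + q) + τ b < 1)
    (hpos : ∃ q, ∀ b, α b ≠ 0 → 0 < height α z b (k + q) + τ b) :
    ∀ q < L, y (s + q) = z (k + q) := by
  have hwrap : ∀ b, ∃ e : ℤ, (∀ q ≤ L, occ y b s q ≤ occ z b k q + e) ∧
      ∀ q, (α b ≠ 0 → 0 < height α z b (k + q) + τ b) → occ z b k q + e ≤ occ y b s q := by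
    intro b
    by_cases hb : α b = 0
    · exact ⟨0, by simp [occ_eq_zero fun _ => hy.ne_of_eq_zero b hb _,
        occ_eq_zero fun _ => hz.ne_of_eq_zero b hb _]⟩
    obtain ⟨e, he⟩ := exists_height_eq_add_intCast (hphase b hb)
    refine ⟨e, fun q hq => ?_, fun q hq => ?_⟩
    · have h : ((-1 : ℤ) : ℝ) < (occ z b k q + e - occ y b s q : ℤ) := by
        rw [Int.cast_neg, Int.cast_one]
        linarith [hlt b hb q hq, he q, hy.height_nonneg b (s + q)]
      linarith [Int.cast_lt.1 h]
    · have h : ((occ z b k q + e - occ y b s q : ℤ) : ℝ) < (1 : ℤ) := by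
        rw [Int.cast_one]
        linarith [hq hb, he q, hy.height_le_one b (s + q)]
      linarith [Int.cast_lt.1 h]
  choose e hle hge using hwrap
  obtain ⟨q, hq⟩ := hpos
  exact apply_eq_of_forall_occ_le_add (fun q hq b => hle b q hq) ⟨q, fun b => hge b q (hq b)⟩

theorem eventually_forall_height_add_lt_one [Finite A] (hz : IsBalancedWith α z) {l : Filter ℝ}
    (hl : l ≤ 𝓝 0)
    (hdown : ∀ b n, α b ≠ 0 → height α z b n = 1 → ∀ᶠ θ : ℝ in l, θ / p b < 0) (k L : ℕ) :
    ∀ᶠ θ : ℝ in l, ∀ b, α b ≠ 0 → ∀ q ≤ L, height α z b (k + q) + θ / p b < 1 := by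
  refine eventually_all.2 fun b => eventually_imp_distrib_left.2 fun hb =>
    (eventually_all_finite (Set.finite_Iic L)).2 fun q _ => ?_
  rcases (hz.height_le_one b (k + q)).eq_or_lt with h | h
  · filter_upwards [hdown b _ hb h] with θ hθ
    linarith
  · exact ((tendsto_height_add_div α z b (p b) _).eventually_lt_const h).filter_mono hl

end IsBalancedWith

namespace IsCommonScale

variable [Finite A]

theorem zsmul_slope_eq (hp : IsCommonScale α a p) (hy : IsBalancedWith α y)
    (ha : ¬ IsOfFinAddOrder (α a : UnitAddCircle)) (hb : α b ≠ 0) :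
    p b • (α b : UnitAddCircle) = p a • (α a : UnitAddCircle) :=
  (mem_syncLetters.1 (hp.mem_syncLetters_of_slope_ne_zero hy ha hb)).1

theorem zsmul_phase_eq (hp : IsCommonScale α a p) (hy : IsBalancedWith α y)
    (ha : ¬ IsOfFinAddOrder (α a : UnitAddCircle)) (hb : α b ≠ 0) (n : ℕ) :
    p b • phase α y b n = p a • phase α y a n :=
  zsmul_phase_eq_of_mem_syncLetters (hp.mem_syncLetters_of_slope_ne_zero hy ha hb) n

theorem slope_not_isOfFinAddOrder (hp : IsCommonScale α a p) (hy : IsBalancedWith α y)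
    (ha : ¬ IsOfFinAddOrder (α a : UnitAddCircle)) (hb : α b ≠ 0) :
    ¬ IsOfFinAddOrder (α b : UnitAddCircle) :=
  hp.not_isOfFinAddOrder ha (hp.zsmul_slope_eq hy ha hb)

theorem eq_of_height_eq_one (hp : IsCommonScale α a p) (hz : IsBalancedWith α z)
    (ha : ¬ IsOfFinAddOrder (α a : UnitAddCircle)) (hb : α b ≠ 0) (hb' : α b' ≠ 0)
    (h : height α z b n = 1) (h' : height α z b' n' = 1) : b = b' := by
  have happly : ∀ {c m}, α c ≠ 0 → height α z c m = 1 → z m = c := fun hc h1 =>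
    hz.eq_of_lt_height (by rw [h1]; linarith [(hz.slope_nonneg _).lt_of_ne' hc])
  have hzero : ∀ {c m}, α c ≠ 0 → height α z c m = 1 → p a • phase α z a m = 0 := fun hc h1 => by
    rw [← hp.zsmul_phase_eq hz ha hc, phase, h1, AddCircle.coe_period, smul_zero]
  have hn : n = n' := zsmul_phase_injective (not_isOfFinAddOrder_zsmul ha (hp.ne_zero a))
    ((hzero hb h).trans (hzero hb' h').symm)
  rw [← happly hb h, hn, happly hb' h']

theorem forall_pos_or_forall_neg_of_height_eq_one (hp : IsCommonScale α a p)
    (hz : IsBalancedWith α z) (ha : ¬ IsOfFinAddOrder (α a : UnitAddCircle)) :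
    (∀ b n, α b ≠ 0 → height α z b n = 1 → 0 < p b) ∨
      ∀ b n, α b ≠ 0 → height α z b n = 1 → p b < 0 := by
  by_contra! h
  obtain ⟨⟨b, n, hb, h1, hneg⟩, c, m, hc, h1', hpos⟩ := h
  rw [← hp.eq_of_height_eq_one hz ha hb hc h1 h1'] at hpos
  exact hp.ne_zero b (hneg.antisymm hpos)

theorem exists_eventually_forall_pos_height_add (hp : IsCommonScale α a p)
    (hz : IsBalancedWith α z) (ha : ¬ IsOfFinAddOrder (α a : UnitAddCircle)) (k : ℕ) :
    ∃ q, ∀ᶠ θ : ℝ in 𝓝 0, ∀ b, α b ≠ 0 → 0 < height α z b (k + q) + θ / p b := by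
  have hnonzero : ∀ᶠ n in atTop, ∀ b, α b ≠ 0 → phase α z b n ≠ 0 := eventually_all.2 fun b =>
    eventually_imp_distrib_left.2 fun hb =>
      eventually_phase_ne_zero (hp.slope_not_isOfFinAddOrder hz ha hb)
  obtain ⟨m, hm, hkm⟩ := (hnonzero.and (eventually_ge_atTop k)).exists
  obtain ⟨q, rfl⟩ := Nat.exists_eq_add_of_le hkm
  refine ⟨q, eventually_all.2 fun b => eventually_imp_distrib_left.2 fun hb => ?_⟩
  have hpos : 0 < height α z b (k + q) := (hz.height_nonneg b _).lt_of_ne' fun h =>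
    hm b hb (by rw [phase, h, AddCircle.coe_zero])
  exact (tendsto_height_add_div α z b (p b) _).eventually_const_lt hpos

theorem exists_forall_height_add_lt_one (hp : IsCommonScale α a p) (hz : IsBalancedWith α z)
    (ha : ¬ IsOfFinAddOrder (α a : UnitAddCircle)) (k L : ℕ) :
    ∃ c d, c < d ∧ ∀ θ ∈ Set.Ioo c d,
      (∀ b, α b ≠ 0 → ∀ q ≤ L, height α z b (k + q) + θ / p b < 1) ∧
      ∃ q, ∀ b, α b ≠ 0 → 0 < height α z b (k + q) + θ / p b := by
  obtain ⟨q₀, hpos⟩ := hp.exists_eventually_forall_pos_height_add hz ha k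
  have hgood : ∀ l ≤ 𝓝 (0 : ℝ),
      (∀ b n, α b ≠ 0 → height α z b n = 1 → ∀ᶠ θ : ℝ in l, θ / p b < 0) →
      ∀ᶠ θ in l, (∀ b, α b ≠ 0 → ∀ q ≤ L, height α z b (k + q) + θ / p b < 1) ∧
        ∃ q, ∀ b, α b ≠ 0 → 0 < height α z b (k + q) + θ / p b := fun l hl hdown =>
    (hz.eventually_forall_height_add_lt_one hl hdown k L).and
      ((hpos.filter_mono hl).mono fun _ h => ⟨q₀, h⟩)
  -- Only one letter can ever have height one: perturb to the side on which its height decreases.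
  rcases hp.forall_pos_or_forall_neg_of_height_eq_one hz ha with h | h
  · obtain ⟨c, hc, hsub⟩ := mem_nhdsLT_iff_exists_Ioo_subset.1 (hgood _ nhdsWithin_le_nhds
      fun b n hb h1 => eventually_nhdsWithin_of_forall fun θ hθ =>
        div_neg_of_neg_of_pos hθ (Int.cast_pos.2 (h b n hb h1)))
    exact ⟨c, 0, hc, hsub⟩
  · obtain ⟨d, hd, hsub⟩ := mem_nhdsGT_iff_exists_Ioo_subset.1 (hgood _ nhdsWithin_le_nhds
      fun b n hb h1 => eventually_nhdsWithin_of_forall fun θ hθ =>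
        div_neg_of_pos_of_neg hθ (Int.cast_lt_zero.2 (h b n hb h1)))
    exact ⟨0, d, hd, hsub⟩

theorem exists_forall_height_eq_add_div (hp : IsCommonScale α a p)
    (ha : ¬ IsOfFinAddOrder (α a : UnitAddCircle)) :
    ∃ N, ∀ y z i j, IsBalancedWith α y → IsBalancedWith α z → (∀ q < N, y (i + q) = z (j + q)) →
      ∃ G : ℝ, ∀ b, α b ≠ 0 → height α y b i = height α z b j + G / p b := by
  obtain ⟨P, hpP⟩ := Finite.exists_le fun b => max 1 |(p b : ℝ)|
  have hpos : 0 < P := one_pos.trans_le ((le_max_left _ _).trans (hpP a))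
  obtain ⟨N, hN⟩ := IsBalancedWith.exists_forall_abs_height_sub_height_le α
    (show 0 < 1 / (3 * P) by positivity)
  refine ⟨N, fun y z i j hy hz hyz => ⟨p a * (height α y a i - height α z a j), fun b hb => ?_⟩⟩
  have hsmall : ∀ {b}, ¬ IsOfFinAddOrder (α b : UnitAddCircle) →
      |p b * (height α y b i - height α z b j)| ≤ 1 / 3 := fun {b} hb => by
    have hpb : |(p b : ℝ)| ≤ P := (le_max_right _ _).trans (hpP b)
    calc _ ≤ P * (1 / (3 * P)) := by
          rw [abs_mul]
          exact mul_le_mul hpb (hN y z i j hy hz hyz b hb) (abs_nonneg _) (by positivity)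
      _ = 1 / 3 := by field_simp
  have hcongr : ((p b * (height α y b i - height α z b j) -
      p a * (height α y a i - height α z a j) : ℝ) : UnitAddCircle) = 0 := by
    have hy' := hp.zsmul_phase_eq hy ha hb i
    have hz' := hp.zsmul_phase_eq hz ha hb j
    simp only [phase] at hy' hz'
    simp only [← zsmul_eq_mul, AddCircle.coe_sub, AddCircle.coe_zsmul, smul_sub, hy', hz', sub_self]
  obtain ⟨e, he⟩ := (AddCircle.coe_eq_zero_iff 1).1 hcongr
  rw [zsmul_eq_mul, mul_one] at he
  have h1 := abs_le.1 (hsmall (hp.slope_not_isOfFinAddOrder hy ha hb))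
  have h2 := abs_le.1 (hsmall ha)
  have hlt : |(e : ℝ)| < 1 := abs_lt.2 ⟨by linarith, by linarith⟩
  have hzero : e = 0 := Int.abs_lt_one_iff.1 (by exact_mod_cast hlt)
  rw [hzero, Int.cast_zero, eq_comm, sub_eq_zero] at he
  rw [← he, mul_div_cancel_left₀ _ (Int.cast_ne_zero.2 (hp.ne_zero b)), add_sub_cancel]

theorem exists_phase_eq_phase_add (hp : IsCommonScale α a p)
    (ha : ¬ IsOfFinAddOrder (α a : UnitAddCircle)) (hy : IsBalancedWith α y) {G : ℝ}
    (hG : ∀ b, α b ≠ 0 → height α y b i = height α z b j + G / p b) (k : ℕ) {c d : ℝ}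
    (hcd : c < d) :
    ∃ s, ∃ θ ∈ Set.Ioo c d, ∀ b, α b ≠ 0 →
      phase α y b s = phase α z b k + (θ / p b : ℝ) := by
  obtain ⟨n, hn, θ, hθ, h⟩ := exists_ge_forall_nsmul_eq_coe_div
    (κ := {b // α b ≠ 0}) (v := fun b => (α b : UnitAddCircle)) (p := fun b => p b)
    (not_isOfFinAddOrder_zsmul ha (hp.ne_zero a)) (fun b => hp.ne_zero b)
    (fun b => hp.zsmul_slope_eq hy ha b.2) j (sub_lt_sub_right hcd G)
  obtain ⟨m, rfl⟩ := Nat.exists_eq_add_of_le hn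
  refine ⟨i + (m + k), θ + G, ⟨sub_lt_iff_lt_add.1 hθ.1, lt_sub_iff_add_lt.1 hθ.2⟩, fun b hb => ?_⟩
  have hi : phase α y b i = phase α z b j + (G / p b : ℝ) := by
    rw [phase, hG b hb, AddCircle.coe_add, phase]
  have hcomm : phase α z b j + k • (α b : UnitAddCircle) =
      phase α z b k + j • (α b : UnitAddCircle) := by
    rw [← phase_add, ← phase_add, add_comm]
  have hτ : ((θ + G) / p b : ℝ) = (((j + m) • (α b : UnitAddCircle) + (G / p b : ℝ) :
      UnitAddCircle)) := by
    rw [add_div, AddCircle.coe_add, h ⟨b, hb⟩]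
  calc phase α y b (i + (m + k))
      = phase α z b j + k • (α b : UnitAddCircle) + m • (α b : UnitAddCircle) +
          (G / p b : ℝ) := by
        rw [phase_add, hi, add_smul]
        abel
    _ = phase α z b k + ((θ + G) / p b : ℝ) := by
        rw [hcomm, hτ, add_smul]
        abel

theorem exists_forall_exists_apply_eq (hp : IsCommonScale α a p)
    (ha : ¬ IsOfFinAddOrder (α a : UnitAddCircle)) :
    ∃ N, ∀ y z i j, IsBalancedWith α y → IsBalancedWith α z → (∀ q < N, y (i + q) = z (j + q)) →
      ∀ k L, ∃ s, ∀ q < L, y (s + q) = z (k + q) := by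
  obtain ⟨N, hN⟩ := hp.exists_forall_height_eq_add_div ha
  refine ⟨N, fun y z i j hy hz hyz k L => ?_⟩
  obtain ⟨G, hG⟩ := hN y z i j hy hz hyz
  obtain ⟨c, d, hcd, hθ⟩ := hp.exists_forall_height_add_lt_one hz ha k L
  obtain ⟨s, θ, hmem, hphase⟩ := hp.exists_phase_eq_phase_add ha hy hG k hcd
  exact ⟨s, hy.apply_eq_of_phase_eq_phase_add hz hphase (hθ θ hmem).1 (hθ θ hmem).2⟩

end IsCommonScale

end CommonFactors

section Subshifts

variable {A : Type*}

theorem language_subset_iff {y z : ℕ → A} :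
    language z ⊆ language y ↔ ∀ i n, ∃ j, ∀ q < n, y (j + q) = z (i + q) := by
  constructor
  · intro h i n
    obtain ⟨j, m, hm⟩ := h ⟨i, n, rfl⟩
    obtain rfl : n = m := by simpa only [length_block] using congrArg List.length hm
    exact ⟨j, block_eq_block_iff.1 hm.symm⟩
  · rintro h _ ⟨i, n, rfl⟩
    obtain ⟨j, hj⟩ := h i n
    exact ⟨j, n, block_eq_block_iff.2 fun q hq => (hj q hq).symm⟩

variable [TopologicalSpace A]

theorem mem_of_language_subset (Y : Subshift A ℕ) {x z : ℕ → A} (hz : z ∈ Y.carrier)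
    (h : language x ⊆ language z) : x ∈ Y.carrier := by
  refine Y.isClosed.closure_subset (mem_closure_iff_nhds.2 fun U hU => ?_)
  rw [nhds_pi, Filter.mem_pi] at hU
  obtain ⟨I, hI, V, hV, hVU⟩ := hU
  obtain ⟨n, hn⟩ := hI.bddAbove
  obtain ⟨j, hj⟩ := language_subset_iff.1 h 0 (n + 1)
  refine ⟨shift j z, hVU fun q hq => ?_, Y.mapsTo j hz⟩
  have hjq : shift j z q = x q :=
    (hj q (Nat.lt_succ_of_le (hn hq))).trans (congrArg x (zero_add q))
  exact hjq ▸ mem_of_mem_nhds (hV q)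

variable [DiscreteTopology A]

/-- The subshift generated by `y`, presented through factors: it consists of the words all of whose
factors are factors of `y`. -/
def languageSubshift (y : ℕ → A) : Subshift A ℕ where
  carrier := {z | language z ⊆ language y}
  isClosed := by
    refine isClosed_of_closure_subset fun z hz => language_subset_iff.2 fun i n => ?_
    have hcyl : (Set.Iio (i + n)).pi (fun q => {z q}) ∈ 𝓝 z :=
      set_pi_mem_nhds (Set.finite_Iio _) fun q _ => mem_nhds_discrete.2 rfl
    obtain ⟨x, hxz, hx⟩ := mem_closure_iff_nhds.1 hz _ hcyl
    obtain ⟨j, hj⟩ := language_subset_iff.1 hx i n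
    exact ⟨j, fun q hq => (hj q hq).trans (hxz (i + q) (Nat.add_lt_add_left hq i))⟩
  mapsTo g z hz := language_subset_iff.2 fun i n => by
    obtain ⟨j, hj⟩ := language_subset_iff.1 hz (g + i) n
    exact ⟨j, fun q hq => (hj q hq).trans (congrArg z (add_assoc g i q))⟩

theorem languageSubshift_congr {y z : ℕ → A} (h : language y = language z) :
    languageSubshift y = languageSubshift z := by
  simp only [languageSubshift, h]

variable {X : Set (ℕ → A)} {N : ℕ}

theorem finite_image_languageSubshift [Finite A]
    (hX : ∀ y ∈ X, ∀ z ∈ X, (∀ q < N, y q = z q) → language y = language z) :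
    (languageSubshift '' X).Finite := by
  choose x hxX hx using fun Y : languageSubshift '' X => Y.2
  refine Finite.of_injective (fun Y (q : Fin N) => x Y q) fun Y Z h => Subtype.ext ?_
  rw [← hx Y, ← hx Z]
  exact languageSubshift_congr (hX _ (hxX Y) _ (hxX Z) fun q hq => congrFun h ⟨q, hq⟩)

theorem isMinimalSubshift_languageSubshift {y : ℕ → A}
    (hy : ∀ z, language z ⊆ language y → language y ⊆ language z) :
    IsMinimalSubshift (languageSubshift y) := by
  refine ⟨⟨y, subset_refl (language y)⟩, fun Y ⟨z, hz⟩ hY => hY.antisymm fun x hx => ?_⟩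
  exact mem_of_language_subset Y hz (Set.Subset.trans hx (hy z (hY hz)))

theorem eq_biUnion_languageSubshift
    (hX : ∀ y ∈ X, ∀ z, language z ⊆ language y → z ∈ X) :
    X = ⋃ Y ∈ languageSubshift '' X, Y.carrier := by
  rw [Set.biUnion_image]
  exact Set.Subset.antisymm (fun y hy => Set.mem_biUnion hy (subset_refl (language y)))
    (Set.iUnion₂_subset hX)

end Subshifts

theorem exists_forall_language_eq {A : Type*} [Finite A] [DecidableEq A] {u : ℕ → A}
    (haper : IsAperiodic u) (hrec : IsRecurrent u) (hbal : IsBalanced u) :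
    ∃ N, ∀ y ∈ abClosure u, ∀ z ∈ abClosure u, ∀ i j, (∀ q < N, y (i + q) = z (j + q)) →
      language y = language z := by
  obtain ⟨α, hα⟩ := exists_isBalancedWith hbal hrec
  obtain ⟨a, ha⟩ := hα.exists_not_isOfFinAddOrder haper
  obtain ⟨p, hp⟩ := exists_isCommonScale (α := α) ha
  obtain ⟨N, hN⟩ := hp.exists_forall_exists_apply_eq ha
  have hsubset : ∀ y ∈ abClosure u, ∀ z ∈ abClosure u, ∀ i j, (∀ q < N, y (i + q) = z (j + q)) →
      language z ⊆ language y := fun y hy z hz i j h => language_subset_iff.2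
    (hN y z i j (hα.of_mem_abClosure hy) (hα.of_mem_abClosure hz) h)
  exact ⟨N, fun y hy z hz i j h => (hsubset z hz y hy j i fun q hq => (h q hq).symm).antisymm
    (hsubset y hy z hz i j h)⟩

end AbelianClosure

/-- The abelian closure of an aperiodic, recurrent, balanced word over a finite alphabet is a
union of finitely many minimal subshifts. -/
theorem mainTheorem1 {A : Type*} [Finite A] [DecidableEq A] [TopologicalSpace A]
    [DiscreteTopology A] (u : ℕ → A) (haper : AbelianClosure.IsAperiodic u)
    (hrec : AbelianClosure.IsRecurrent u) (hbal : AbelianClosure.IsBalanced u) :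
    ∃ S : Set (Subshift A ℕ), S.Finite ∧ (∀ X ∈ S, AbelianClosure.IsMinimalSubshift X) ∧
      AbelianClosure.abClosure u = ⋃ X ∈ S, X.carrier := by
  open AbelianClosure in
  obtain ⟨N, hN⟩ := exists_forall_language_eq haper hrec hbal
  have hclosed : ∀ y ∈ abClosure u, ∀ z, language z ⊆ language y → z ∈ abClosure u :=
    fun y hy z hz v hv => hy v (hz hv)
  refine ⟨languageSubshift '' abClosure u, ?_, ?_, eq_biUnion_languageSubshift hclosed⟩
  · refine finite_image_languageSubshift (N := N) fun y hy z hz h => hN y hy z hz 0 0 fun q hq => ?_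
    simpa only [zero_add] using h q hq
  · rintro _ ⟨y, hy, rfl⟩
    refine isMinimalSubshift_languageSubshift fun z hzy => ?_
    obtain ⟨j, hj⟩ := language_subset_iff.1 hzy 0 N
    exact (hN y hy z (hclosed y hy z hzy) j 0 hj).subset
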